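/- **Theorem 1 (Best Oblivious DJL Confidence).** Let $1\le n<m$ be integers and $0<\epsilon<\frac12$. Define $$\delta^{\mathrm{Best}}(m,n,\epsilon)=\inf_{\mathcal A}\ \sup_{x\in\mathbb R^m}\ \mathbb P_{A\sim\mathcal A}\Big[\,\big|\|Ax\|_2^2-\|x\|_2^2\big|>\epsilon\|x\|_2^2\Big],$$ where $\mathcal A$ ranges over all probability distributions on the real $n\times m$ matrices. Let $\mathsf{Beta}(a,b)$ be the Beta distribution with shape parameters $a,b$, and let $I_{n,m}$ be the $n\times m$ matrix with ones on the principal diagonal and zeros elsewhere. Then the infimum over $\mathcal A$ is attained, the maximum below over $\lambda\in\mathbb R$ exists, and $$\delta^{\mathrm{Best}}(m,n,\epsilon)=1-\max_{\lambda}\ \mathbb P\Big[(1-\epsilon)\lambda\le \mathsf{Beta}\big(\tfrac n2,\tfrac{m-n}2\big)\le(1+\epsilon)\lambda\Big].$$ Furthermore, let $\lambda$ be any maximizer of the right-hand side probability. Then $\lambda>0$, and if $U$ and $V$ are independent and uniformly (Haar) distributed on the orthogonal groups $\mathcal O(n)$ and $\mathcal O(m)$, the distribution of the random matrix $$A^{\mathrm{Best}}=\lambda^{-1/2}\,U\,I_{n,m}\,V^{T}$$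 attains the infimum, i.e. $\sup_{x\in\mathbb R^m}\mathbb P\big[\,|\|A^{\mathrm{Best}}x\|_2^2-\|x\|_2^2|>\epsilon\|x\|_2^2\big]=\delta^{\mathrm{Best}}(m,n,\epsilon)$. -/

import Mathlib

open MeasureTheory ProbabilityTheory
open scoped ENNReal Matrix

noncomputable section

namespace DJL

/-- Matrices carry the product σ-algebra of their entries (which is the Borel one, see below). -/
instance instMeasurableSpaceMatrix (n m : ℕ) : MeasurableSpace (Matrix (Fin n) (Fin m) ℝ) :=
  inferInstanceAs (MeasurableSpace (Fin n → Fin m → ℝ))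

instance instBorelSpaceMatrix (n m : ℕ) : BorelSpace (Matrix (Fin n) (Fin m) ℝ) :=
  inferInstanceAs (BorelSpace (Fin n → Fin m → ℝ))

instance instSecondCountableMatrix (n m : ℕ) :
    SecondCountableTopology (Matrix (Fin n) (Fin m) ℝ) :=
  inferInstanceAs (SecondCountableTopology (Fin n → Fin m → ℝ))

/-- The orthogonal group `O(d)` is compact. -/
instance instCompactSpaceOrthogonal (d : ℕ) :
    CompactSpace (Matrix.orthogonalGroup (Fin d) ℝ) := by
  refine (isCompact_iff_compactSpace
    (s := (Matrix.orthogonalGroup (Fin d) ℝ : Set (Matrix (Fin d) (Fin d) ℝ)))).mp ?_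
  have hK : IsCompact (Set.univ.pi fun _ : Fin d => Set.univ.pi fun _ : Fin d =>
      Metric.closedBall (0 : ℝ) 1) :=
    isCompact_univ_pi fun _ => isCompact_univ_pi fun _ => isCompact_closedBall _ _
  refine IsCompact.of_isClosed_subset (X := Matrix (Fin d) (Fin d) ℝ) hK
    (isClosed_unitary (R := Matrix (Fin d) (Fin d) ℝ)) ?_
  intro U hU i _ j _
  simpa using entry_norm_bound_of_unitary hU i j

instance instSecondCountableOrthogonal (d : ℕ) :
    SecondCountableTopology (Matrix.orthogonalGroup (Fin d) ℝ) :=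
  TopologicalSpace.Subtype.secondCountableTopology
    (Matrix.orthogonalGroup (Fin d) ℝ : Set (Matrix (Fin d) (Fin d) ℝ))

/-- The uniform distribution on `O(d)`: the normalized Haar measure. -/
def uniformOrthogonal (d : ℕ) : ProbabilityMeasure (Matrix.orthogonalGroup (Fin d) ℝ) :=
  ⟨Measure.haarMeasure ⊤, ⟨by
    simpa using Measure.haarMeasure_self
      (K₀ := (⊤ : TopologicalSpace.PositiveCompacts (Matrix.orthogonalGroup (Fin d) ℝ)))⟩⟩

/-- `I_{n,m}`: the `n × m` matrix with ones on the principal diagonal and zeros elsewhere. -/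
def rectId (n m : ℕ) : Matrix (Fin n) (Fin m) ℝ :=
  Matrix.of fun i j => if (i : ℕ) = (j : ℕ) then 1 else 0

/-- The matrix `l^{-1/2} U I_{n,m} Vᵀ`. -/
def scaledProjection (n m : ℕ) (l : ℝ)
    (p : Matrix.orthogonalGroup (Fin n) ℝ × Matrix.orthogonalGroup (Fin m) ℝ) :
    Matrix (Fin n) (Fin m) ℝ :=
  l ^ (-(1 / 2) : ℝ) • ((p.1 : Matrix (Fin n) (Fin n) ℝ) * rectId n m *
    (p.2 : Matrix (Fin m) (Fin m) ℝ)ᵀ)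

theorem measurable_scaledProjection (n m : ℕ) (l : ℝ) :
    Measurable (scaledProjection n m l) := by
  have h : Continuous (scaledProjection n m l) := by
    unfold scaledProjection
    have h1 : Continuous fun p : Matrix.orthogonalGroup (Fin n) ℝ ×
        Matrix.orthogonalGroup (Fin m) ℝ => (p.1 : Matrix (Fin n) (Fin n) ℝ) :=
      continuous_subtype_val.comp continuous_fst
    have h2 : Continuous fun p : Matrix.orthogonalGroup (Fin n) ℝ ×
        Matrix.orthogonalGroup (Fin m) ℝ => (p.2 : Matrix (Fin m) (Fin m) ℝ) :=
      continuous_subtype_val.comp continuous_snd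
    exact Continuous.const_smul
      ((h1.matrix_mul continuous_const).matrix_mul h2.matrix_transpose) (l ^ (-(1 / 2) : ℝ))
  exact h.measurable

/-- The law of the random matrix `l^{-1/2} U I_{n,m} Vᵀ`, where `U` and `V` are independent and
uniform on `O(n)` and `O(m)`. -/
def haarProjectionLaw (n m : ℕ) (l : ℝ) : ProbabilityMeasure (Matrix (Fin n) (Fin m) ℝ) :=
  ((uniformOrthogonal n).prod (uniformOrthogonal m)).map
    (measurable_scaledProjection n m l).aemeasurable

/-- The event, for the matrix `A`, that the input `x` is distorted by more than `ε`:
`|‖A x‖₂² - ‖x‖₂²| > ε ‖x‖₂²`. -/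
def distortionEvent {n m : ℕ} (ε : ℝ) (x : EuclideanSpace ℝ (Fin m)) :
    Set (Matrix (Fin n) (Fin m) ℝ) :=
  {A | |‖(WithLp.toLp 2 (A *ᵥ x.ofLp) : EuclideanSpace ℝ (Fin n))‖ ^ 2 - ‖x‖ ^ 2|
    > ε * ‖x‖ ^ 2}

/-- The distortion probability of the distribution `𝒜` at its worst input:
`sup_x P_{A ∼ 𝒜}[|‖A x‖₂² - ‖x‖₂²| > ε ‖x‖₂²]`. -/
def worstDistortion {n m : ℕ} (ε : ℝ) (𝒜 : ProbabilityMeasure (Matrix (Fin n) (Fin m) ℝ)) :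
    ℝ≥0∞ :=
  ⨆ x : EuclideanSpace ℝ (Fin m), (𝒜 : Measure (Matrix (Fin n) (Fin m) ℝ)) (distortionEvent ε x)

/-- `δ^Best(m, n, ε)`: the infimum of the worst-input distortion probability over all
probability distributions on `n × m` matrices. -/
def deltaBest (m n : ℕ) (ε : ℝ) : ℝ≥0∞ :=
  ⨅ 𝒜 : ProbabilityMeasure (Matrix (Fin n) (Fin m) ℝ), worstDistortion ε 𝒜

/-- `P[(1 - ε) l ≤ Beta(n/2, (m-n)/2) ≤ (1 + ε) l]`. -/
def betaWindow (m n : ℕ) (ε l : ℝ) : ℝ≥0∞ :=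
  betaMeasure ((n : ℝ) / 2) (((m : ℝ) - n) / 2) (Set.Icc ((1 - ε) * l) ((1 + ε) * l))

end DJL

end

/-! ### Radial integrals that produce the Beta law -/

namespace DJL

open Set

/-! The lower bound averages over inputs: the worst-case failure probability is at least the average
over `x` uniform in the unit ball, so by Tonelli it suffices to bound, for each fixed matrix `A`,
the fraction of the ball that `A` nearly preserves. Choose `N` inside `ker A` of dimension exactly
`m - n`, put `K = Nᗮ`, and write `x = r θ + z` with `θ` a unit vector of `K` and `z ∈ N`. Then `‖A
x‖² / ‖x‖² = t ‖A θ‖²` with `t = r² / (r² + ‖z‖²)`. In bi-polar coordinates `t` is Beta(n/2,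
(m-n)/2) distributed and independent of `θ`. Conditionally on `θ`, success is therefore a window
event with `l = ‖A θ‖⁻²` (impossible if `A θ = 0`), of probability at most the maximum
(`volume_nearIsometrySet_inter_ball_le`, `one_sub_le_worstDistortion`).

Equality needs `‖A θ‖²` constant on the unit sphere of `K`, which holds for a scaled coordinate
projection, and a failure probability independent of the input, which Haar invariance supplies. For
every `x ≠ 0` that probability thus equals its average over the ball, namely one minus the window
probability (`worstDistortion_haarProjectionLaw`). A maximizing `l` exists by continuity and
compactness, and meets the lower bound. -/

theorem lintegral_Ioi_comp_mul_left {c : ℝ} (hc : 0 < c) (f : ℝ → ℝ≥0∞) :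
    ∫⁻ x in Ioi 0, f x = ENNReal.ofReal c * ∫⁻ x in Ioi 0, f (c * x) := by
  have himg : (fun x : ℝ => c * x) '' Ioi 0 = Ioi 0 := by
    rw [image_mul_left_Ioi hc, mul_zero]
  have h := lintegral_image_eq_lintegral_abs_deriv_mul (s := Ioi (0 : ℝ)) (f := fun x => c * x)
    (f' := fun _ => c) measurableSet_Ioi
    (fun x _ => by simpa using ((hasDerivAt_id x).const_mul c).hasDerivWithinAt)
    (fun x _ y _ hxy => mul_left_cancel₀ hc.ne' hxy) f
  rw [himg] at h
  rw [h, abs_of_pos hc, lintegral_const_mul' _ _ ENNReal.ofReal_ne_top]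

theorem sq_rpow_half_sub_one {x : ℝ} (hx : 0 < x) (k : ℕ) :
    (x ^ 2) ^ (((k : ℝ) + 1) / 2 - 1) = x ^ k * x⁻¹ := by
  rw [← Real.rpow_natCast x 2, ← Real.rpow_mul hx.le,
    show ((2 : ℕ) : ℝ) * (((k : ℝ) + 1) / 2 - 1) = (k : ℝ) + (-1) by push_cast; ring,
    Real.rpow_add hx, Real.rpow_natCast, Real.rpow_neg_one]

/-- The left side is the Jacobian of `v ↦ 1 / (1 + v²)` times a Beta density with constant `c`. Both
`1 / (1 + v²)` and its complement to one are squares, so the half-integer exponents become integral.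
-/
theorem beta_density_change_of_variables (p q : ℕ) (c : ℝ) {v : ℝ} (hv : 0 < v) :
    2 * v / (1 + v ^ 2) ^ 2 * (c * (1 / (1 + v ^ 2)) ^ (((p : ℝ) + 1) / 2 - 1)
      * (1 - 1 / (1 + v ^ 2)) ^ (((q : ℝ) + 1) / 2 - 1)) =
    2 * c * (v ^ q * (√(1 + v ^ 2))⁻¹ ^ (p + q + 2)) := by
  have hs : 0 < √(1 + v ^ 2) := by positivity
  have hsq : 1 + v ^ 2 = √(1 + v ^ 2) ^ 2 := (Real.sq_sqrt (by positivity)).symm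
  set s := √(1 + v ^ 2)
  have h1 : 1 / (1 + v ^ 2) = (s⁻¹) ^ 2 := by rw [hsq]; simp
  have h2 : 1 - 1 / (1 + v ^ 2) = (v * s⁻¹) ^ 2 := by
    rw [one_sub_div (by positivity), hsq, mul_pow, inv_pow, ← div_eq_mul_inv, ← hsq]
    simp
  rw [h2, h1, sq_rpow_half_sub_one (by positivity), sq_rpow_half_sub_one (by positivity), hsq]
  rw [mul_pow v]
  have h3 : s⁻¹ ^ (p + q + 2) = s⁻¹ ^ p * s⁻¹ ^ q * s⁻¹ ^ 2 := by ring
  rw [h3]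
  generalize s⁻¹ ^ p = x
  generalize s⁻¹ ^ q = y
  field_simp

/-- The law of `1 / (1 + v²)`, for `v` with density proportional to
`v ^ q (1 + v²) ^ (-(p + q + 2) / 2)`, is a Beta distribution. -/
theorem lintegral_one_div_one_add_sq (p q : ℕ) {S : Set ℝ} (hS : MeasurableSet S) :
    ∫⁻ v in Ioi (0 : ℝ), ENNReal.ofReal (v ^ q * (√(1 + v ^ 2))⁻¹ ^ (p + q + 2)) *
      S.indicator 1 (1 / (1 + v ^ 2)) =
    ENNReal.ofReal (beta (((p : ℝ) + 1) / 2) (((q : ℝ) + 1) / 2) / 2) *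
      betaMeasure (((p : ℝ) + 1) / 2) (((q : ℝ) + 1) / 2) S := by
  set a := ((p : ℝ) + 1) / 2
  set b := ((q : ℝ) + 1) / 2
  have hb : 0 < beta a b := beta_pos (by positivity) (by positivity)
  have hlt : ∀ v : ℝ, 0 < v → 0 < 1 / (1 + v ^ 2) ∧ 1 / (1 + v ^ 2) < 1 := fun v hv =>
    ⟨by positivity, (div_lt_one (by positivity)).2 (by nlinarith)⟩
  have himg : (fun v : ℝ => 1 / (1 + v ^ 2)) '' Ioi 0 = Ioo 0 1 := by
    ext t
    constructor
    · rintro ⟨v, hv, rfl⟩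
      exact hlt v hv
    · rintro ⟨h0, h1⟩
      have h2 : 0 < 1 / t - 1 := by rw [sub_pos, lt_div_iff₀ h0]; linarith
      refine ⟨√(1 / t - 1), Real.sqrt_pos.2 h2, ?_⟩
      simp only [Real.sq_sqrt h2.le]
      field_simp
      ring
  have hinj : InjOn (fun v : ℝ => 1 / (1 + v ^ 2)) (Ioi 0) := by
    intro x hx y hy hxy
    simp only [one_div, inv_inj, add_right_inj] at hxy
    exact (sq_eq_sq₀ (le_of_lt hx) (le_of_lt hy)).1 hxy
  have hd : ∀ v ∈ Ioi (0 : ℝ), HasDerivWithinAt (fun v : ℝ => 1 / (1 + v ^ 2))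
      (-(2 * v) / (1 + v ^ 2) ^ 2) (Ioi 0) v := by
    intro v hv
    have h := (((hasDerivAt_pow 2 v).const_add 1).inv (by positivity)).hasDerivWithinAt (s := Ioi 0)
    simpa [one_div] using! h
  have key := lintegral_image_eq_lintegral_abs_deriv_mul measurableSet_Ioi hd hinj
    (fun t => betaPDF a b t * S.indicator 1 t)
  have hβ : betaMeasure a b S = ∫⁻ t in Ioo 0 1, betaPDF a b t * S.indicator 1 t := by
    rw [betaMeasure, withDensity_apply _ hS, ← lintegral_indicator hS,
      ← lintegral_indicator measurableSet_Ioo]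
    congr 1
    ext t
    by_cases ht : t ∈ Ioo (0 : ℝ) 1
    · by_cases htS : t ∈ S <;> simp [ht, htS]
    · have : betaPDF a b t = 0 := by
        rw [betaPDF_eq, if_neg (by simpa using ht), ENNReal.ofReal_zero]
      by_cases htS : t ∈ S <;> simp [ht, htS, this]
  rw [hβ, ← himg, key, ← lintegral_const_mul' _ _ ENNReal.ofReal_ne_top]
  refine setLIntegral_congr_fun measurableSet_Ioi fun v (hv : 0 < v) => ?_
  rw [← mul_assoc, ← mul_assoc, betaPDF_of_pos_lt_one (hlt v hv).1 (hlt v hv).2,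
    ← ENNReal.ofReal_mul (by positivity), ← ENNReal.ofReal_mul (by positivity)]
  congr 2
  rw [neg_div, abs_neg, abs_of_pos (by positivity), mul_assoc,
    beta_density_change_of_variables p q _ hv]
  field_simp

/-- For `(r, s)` with density `r ^ p s ^ q w(√(r² + s²))` on the quadrant, the ratio
`r² / (r² + s²)` follows a Beta distribution. -/
theorem lintegral_lintegral_ratio_sq (p q : ℕ) {w : ℝ → ℝ≥0∞} (hw : Measurable w)
    {S : Set ℝ} (hS : MeasurableSet S) :
    ∫⁻ r in Ioi (0 : ℝ), ENNReal.ofReal (r ^ p) * ∫⁻ s in Ioi (0 : ℝ), ENNReal.ofReal (s ^ q) *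
      (w (√(r ^ 2 + s ^ 2)) * S.indicator 1 (r ^ 2 / (r ^ 2 + s ^ 2))) =
    (∫⁻ t in Ioi (0 : ℝ), ENNReal.ofReal (t ^ (p + q + 1)) * w t) *
      (ENNReal.ofReal (beta (((p : ℝ) + 1) / 2) (((q : ℝ) + 1) / 2) / 2) *
        betaMeasure (((p : ℝ) + 1) / 2) (((q : ℝ) + 1) / 2) S) := by
  have hind : Measurable (S.indicator (1 : ℝ → ℝ≥0∞)) := measurable_one.indicator hS
  -- Substituting `s = r v` makes the ratio depend on `v` alone.
  have step1 : ∀ r ∈ Ioi (0 : ℝ), ENNReal.ofReal (r ^ p) *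
      ∫⁻ s in Ioi (0 : ℝ), ENNReal.ofReal (s ^ q) *
        (w (√(r ^ 2 + s ^ 2)) * S.indicator 1 (r ^ 2 / (r ^ 2 + s ^ 2))) =
      ∫⁻ v in Ioi (0 : ℝ), ENNReal.ofReal (v ^ q) * S.indicator 1 (1 / (1 + v ^ 2)) *
        (ENNReal.ofReal (r ^ (p + q + 1)) * w (√(1 + v ^ 2) * r)) := by
    intro r (hr : 0 < r)
    rw [lintegral_Ioi_comp_mul_left hr, ← lintegral_const_mul' _ _ ENNReal.ofReal_ne_top,
      ← lintegral_const_mul' _ _ ENNReal.ofReal_ne_top]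
    refine setLIntegral_congr_fun measurableSet_Ioi fun v (hv : 0 < v) => ?_
    have h1 : √(r ^ 2 + (r * v) ^ 2) = √(1 + v ^ 2) * r := by
      rw [show r ^ 2 + (r * v) ^ 2 = (1 + v ^ 2) * r ^ 2 by ring,
        Real.sqrt_mul (by positivity), Real.sqrt_sq hr.le]
    have h2 : r ^ 2 / (r ^ 2 + (r * v) ^ 2) = 1 / (1 + v ^ 2) := by
      field_simp
    have h3 : ENNReal.ofReal (r ^ (p + q + 1)) =
        ENNReal.ofReal (r ^ p) * ENNReal.ofReal r * ENNReal.ofReal (r ^ q) := by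
      rw [← ENNReal.ofReal_mul (by positivity), ← ENNReal.ofReal_mul (by positivity)]
      congr 1
      ring
    simp only [h1, h2]
    rw [h3, mul_pow, ENNReal.ofReal_mul (by positivity)]
    ring
  rw [setLIntegral_congr_fun measurableSet_Ioi step1, lintegral_lintegral_swap (by fun_prop),
    ← lintegral_one_div_one_add_sq p q hS,
    ← lintegral_const_mul _ (by fun_prop)]
  refine setLIntegral_congr_fun measurableSet_Ioi fun v (hv : 0 < v) => ?_
  have hs : 0 < √(1 + v ^ 2) := by positivity
  rw [lintegral_const_mul _ (by fun_prop),
    lintegral_Ioi_comp_mul_left (inv_pos.2 hs), ← lintegral_const_mul' _ _ ENNReal.ofReal_ne_top]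
  -- For fixed `v`, rescaling `r` by `(√(1 + v²))⁻¹` removes `v` from the argument of `w`, so the
  -- radial integral factors out.
  have : ∀ x ∈ Ioi (0 : ℝ), ENNReal.ofReal (√(1 + v ^ 2))⁻¹ *
      (ENNReal.ofReal (((√(1 + v ^ 2))⁻¹ * x) ^ (p + q + 1)) *
        w (√(1 + v ^ 2) * ((√(1 + v ^ 2))⁻¹ * x))) =
      ENNReal.ofReal ((√(1 + v ^ 2))⁻¹ ^ (p + q + 2)) *
        (ENNReal.ofReal (x ^ (p + q + 1)) * w x) := by
    intro x hx
    rw [mul_inv_cancel_left₀ hs.ne', mul_pow, ← mul_assoc, ← mul_assoc,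
      ← ENNReal.ofReal_mul (by positivity), ← ENNReal.ofReal_mul (by positivity)]
    congr 2
    ring
  rw [setLIntegral_congr_fun measurableSet_Ioi this,
    lintegral_const_mul' _ _ ENNReal.ofReal_ne_top, ENNReal.ofReal_mul (by positivity)]
  ring

/-- Integration in polar coordinates. -/
theorem lintegral_eq_lintegral_sphere {E : Type*} [NormedAddCommGroup E] [NormedSpace ℝ E]
    [MeasurableSpace E] [BorelSpace E] [FiniteDimensional ℝ E] [Nontrivial E] (μ : Measure E)
    [μ.IsAddHaarMeasure] {f : E → ℝ≥0∞} (hf : Measurable f) :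
    ∫⁻ x, f x ∂μ = ∫⁻ θ, (∫⁻ r in Ioi (0 : ℝ),
      ENNReal.ofReal (r ^ (Module.finrank ℝ E - 1)) * f (r • (θ : E))) ∂μ.toSphere := by
  have h0 : ∫⁻ x, f x ∂μ = ∫⁻ x : ({(0)}ᶜ : Set E), f x ∂(μ.comap (↑)) := by
    rw [lintegral_subtype_comap (measurableSet_singleton _).compl f, restrict_compl_singleton]
  have h1 := (μ.measurePreserving_homeomorphUnitSphereProd).lintegral_comp_emb
    (Homeomorph.measurableEmbedding _)
    (fun y : Metric.sphere (0 : E) 1 × Ioi (0 : ℝ) => f ((y.2 : ℝ) • (y.1 : E)))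
  have h2 : ∀ x : ({(0)}ᶜ : Set E), f (((homeomorphUnitSphereProd E x).2 : ℝ) •
      ((homeomorphUnitSphereProd E x).1 : E)) = f x := by
    intro x
    have hx : ‖(x : E)‖ ≠ 0 := norm_ne_zero_iff.2 x.2
    simp [smul_smul, hx]
  simp_rw [h2] at h1
  rw [h0, h1, lintegral_prod _ (by fun_prop)]
  refine lintegral_congr fun θ => ?_
  rw [Measure.volumeIoiPow, lintegral_withDensity_eq_lintegral_mul _ (by fun_prop) (by fun_prop)]
  exact lintegral_subtype_comap measurableSet_Ioi
    fun r : ℝ => ENNReal.ofReal (r ^ (Module.finrank ℝ E - 1)) * f (r • (θ : E))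

end DJL

/-! ### The Beta law in the unit ball -/

namespace DJL

open Set Module

section Polar

variable {F G : Type*} [NormedAddCommGroup F] [InnerProductSpace ℝ F] [FiniteDimensional ℝ F]
  [MeasurableSpace F] [BorelSpace F] [Nontrivial F]
  [NormedAddCommGroup G] [InnerProductSpace ℝ G] [FiniteDimensional ℝ G]
  [MeasurableSpace G] [BorelSpace G] [Nontrivial G]

/-- Bi-polar coordinates `y = r θ`, `z = s φ`: the ratio `r² / (r² + s²)` is Beta distributed,
independently of the direction `θ`. -/
theorem exists_volume_inter_ball_prod_eq :
    ∃ C : ℝ≥0∞, ∀ (T : Set (F × G)) (S : Metric.sphere (0 : F) 1 → Set ℝ), MeasurableSet T →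
      (∀ θ, MeasurableSet (S θ)) →
      (∀ (θ : Metric.sphere (0 : F) 1) (r : ℝ) (z : G), 0 < r → z ≠ 0 →
        ((r • (θ : F), z) ∈ T ↔ r ^ 2 / (r ^ 2 + ‖z‖ ^ 2) ∈ S θ)) →
      (volume.prod volume) (T ∩ {p : F × G | √(‖p.1‖ ^ 2 + ‖p.2‖ ^ 2) < 1}) =
        C * ∫⁻ θ, betaMeasure ((finrank ℝ F : ℝ) / 2) ((finrank ℝ G : ℝ) / 2) (S θ)
          ∂(volume : Measure F).toSphere := by
  obtain ⟨p, hp⟩ : ∃ p, finrank ℝ F = p + 1 := Nat.exists_eq_succ_of_ne_zero finrank_pos.ne'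
  obtain ⟨q, hq⟩ : ∃ q, finrank ℝ G = q + 1 := Nat.exists_eq_succ_of_ne_zero finrank_pos.ne'
  -- This radial weight encodes the open unit ball.
  set w : ℝ → ℝ≥0∞ := (Iio 1).indicator 1 with hwdef
  have hw : Measurable w := measurable_one.indicator measurableSet_Iio
  refine ⟨(volume : Measure G).toSphere univ *
    ((∫⁻ t in Ioi (0 : ℝ), ENNReal.ofReal (t ^ (p + q + 1)) * w t) *
      ENNReal.ofReal (beta (((p : ℝ) + 1) / 2) (((q : ℝ) + 1) / 2) / 2)), ?_⟩
  have hC : (volume : Measure G).toSphere univ *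
    ((∫⁻ t in Ioi (0 : ℝ), ENNReal.ofReal (t ^ (p + q + 1)) * w t) *
      ENNReal.ofReal (beta (((p : ℝ) + 1) / 2) (((q : ℝ) + 1) / 2) / 2)) ≠ ∞ := by
    refine ENNReal.mul_ne_top (measure_ne_top _ _) (ENNReal.mul_ne_top ?_ ENNReal.ofReal_ne_top)
    refine ne_top_of_le_ne_top (b := volume (Ioo (0 : ℝ) 1)) (by simp) ?_
    rw [← lintegral_indicator measurableSet_Ioi, ← setLIntegral_one,
      ← lintegral_indicator measurableSet_Ioo]
    refine lintegral_mono fun t => ?_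
    by_cases h0 : 0 < t
    · by_cases h1 : t < 1
      · have : t ^ (p + q + 1) ≤ 1 := pow_le_one₀ h0.le h1.le
        simp [hwdef, h0, h1, this]
      · simp [hwdef, h0, h1]
    · simp [h0]
  intro T S hT hS h
  have hind : Measurable (T.indicator (1 : F × G → ℝ≥0∞)) := measurable_one.indicator hT
  have hf : Measurable fun x : F × G => w (√(‖x.1‖ ^ 2 + ‖x.2‖ ^ 2)) * T.indicator 1 x := by
    fun_prop
  have hmeas : MeasurableSet (T ∩ {p : F × G | √(‖p.1‖ ^ 2 + ‖p.2‖ ^ 2) < 1}) :=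
    hT.inter (measurableSet_lt (by fun_prop) measurable_const)
  have h0 : (volume.prod volume) (T ∩ {p : F × G | √(‖p.1‖ ^ 2 + ‖p.2‖ ^ 2) < 1}) =
      ∫⁻ y : F, ∫⁻ z : G, w (√(‖y‖ ^ 2 + ‖z‖ ^ 2)) * T.indicator 1 (y, z) := by
    rw [← lintegral_prod (fun x : F × G => w (√(‖x.1‖ ^ 2 + ‖x.2‖ ^ 2)) * T.indicator 1 x)
      hf.aemeasurable, ← lintegral_indicator_one hmeas]
    refine lintegral_congr fun x => ?_
    by_cases hx : x ∈ T <;> by_cases hx' : √(‖x.1‖ ^ 2 + ‖x.2‖ ^ 2) < 1 <;>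
      simp [hwdef, hx, hx']
  rw [h0, lintegral_eq_lintegral_sphere _ hf.lintegral_prod_right', ← lintegral_const_mul' _ _ hC]
  refine lintegral_congr fun θ => ?_
  have hθ : ‖(θ : F)‖ = 1 := by simp
  have inner : ∀ r ∈ Ioi (0 : ℝ), ENNReal.ofReal (r ^ (finrank ℝ F - 1)) *
      ∫⁻ z : G, w (√(‖r • (θ : F)‖ ^ 2 + ‖z‖ ^ 2)) * T.indicator 1 (r • (θ : F), z) =
      (volume : Measure G).toSphere univ * (ENNReal.ofReal (r ^ p) *
        ∫⁻ s in Ioi (0 : ℝ), ENNReal.ofReal (s ^ q) *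
        (w (√(r ^ 2 + s ^ 2)) * (S θ).indicator 1 (r ^ 2 / (r ^ 2 + s ^ 2)))) := by
    intro r (hr : 0 < r)
    rw [lintegral_eq_lintegral_sphere volume (by fun_prop)]
    have : ∀ φ : Metric.sphere (0 : G) 1,
        ∫⁻ s in Ioi (0 : ℝ), ENNReal.ofReal (s ^ (finrank ℝ G - 1)) *
          (w (√(‖r • (θ : F)‖ ^ 2 + ‖s • (φ : G)‖ ^ 2)) *
            T.indicator 1 (r • (θ : F), s • (φ : G))) =
        ∫⁻ s in Ioi (0 : ℝ), ENNReal.ofReal (s ^ q) *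
          (w (√(r ^ 2 + s ^ 2)) * (S θ).indicator 1 (r ^ 2 / (r ^ 2 + s ^ 2))) := by
      intro φ
      refine setLIntegral_congr_fun measurableSet_Ioi fun s (hs : 0 < s) => ?_
      have hφ : ‖(φ : G)‖ = 1 := by simp
      have hsφ : ‖s • (φ : G)‖ = s := by rw [norm_smul, hφ, mul_one, Real.norm_of_nonneg hs.le]
      have hrθ : ‖r • (θ : F)‖ = r := by rw [norm_smul, hθ, mul_one, Real.norm_of_nonneg hr.le]
      have hne : s • (φ : G) ≠ 0 := by
        rw [← norm_ne_zero_iff, hsφ]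
        exact hs.ne'
      have hiff := h θ r _ hr hne
      rw [hsφ] at hiff
      simp only [hsφ, hrθ, hq, Nat.add_sub_cancel]
      congr 2
      by_cases hmem : r ^ 2 / (r ^ 2 + s ^ 2) ∈ S θ
      · rw [indicator_of_mem hmem, indicator_of_mem (hiff.2 hmem)]
        rfl
      · rw [indicator_of_notMem hmem, indicator_of_notMem (mt hiff.1 hmem)]
    simp_rw [this]
    rw [lintegral_const, hp, Nat.add_sub_cancel]
    ring
  rw [setLIntegral_congr_fun measurableSet_Ioi inner, lintegral_const_mul' _ _ (measure_ne_top _ _),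
    lintegral_lintegral_ratio_sq p q hw (hS θ), hp, hq]
  push_cast
  ring

end Polar

variable {E : Type*} [NormedAddCommGroup E] [InnerProductSpace ℝ E] [FiniteDimensional ℝ E]
  [MeasurableSpace E] [BorelSpace E]

/-- The orthogonal splitting of `E` into `K` and `Kᗮ` preserves volume, which reduces this to the
product case. The constant is never evaluated: since it does not depend on `T`, taking `T = univ`
expresses it through the volume of the ball. -/
theorem exists_volume_inter_ball_eq (K : Submodule ℝ E) [Nontrivial K] [Nontrivial Kᗮ] :
    ∃ C : ℝ≥0∞, ∀ (T : Set E) (S : Metric.sphere (0 : K) 1 → Set ℝ), MeasurableSet T →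
      (∀ θ, MeasurableSet (S θ)) →
      (∀ (θ : Metric.sphere (0 : K) 1) (r : ℝ) (z : Kᗮ), 0 < r → z ≠ 0 →
        (r • ((θ : K) : E) + z ∈ T ↔ r ^ 2 / (r ^ 2 + ‖z‖ ^ 2) ∈ S θ)) →
      volume (T ∩ Metric.ball 0 1) =
        C * ∫⁻ θ, betaMeasure ((finrank ℝ K : ℝ) / 2) ((finrank ℝ Kᗮ : ℝ) / 2) (S θ)
          ∂(volume : Measure K).toSphere := by
  obtain ⟨C, hC⟩ := exists_volume_inter_ball_prod_eq (F := K) (G := Kᗮ)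
  refine ⟨C, fun T S hT hS h => ?_⟩
  have hmp : MeasurePreserving (fun x : E => WithLp.ofLp (K.orthogonalDecomposition x)) :=
    (WithLp.volume_preserving_ofLp K Kᗮ).comp K.orthogonalDecomposition.measurePreserving
  have hadd : Measurable fun p : K × Kᗮ => (p.1 : E) + p.2 := by fun_prop
  have hinv : ∀ x : E, (K.orthogonalProjectionOnto x : E) + Kᗮ.orthogonalProjectionOnto x = x :=
    fun x => by simp
  rw [← hC ((fun p : K × Kᗮ => (p.1 : E) + p.2) ⁻¹' T) S (hadd hT) hS
    (fun θ r z hr hz => by simpa using h θ r z hr hz), ← Measure.volume_eq_prod,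
    ← hmp.measure_preimage (((hadd hT).inter
      (measurableSet_lt (by fun_prop) measurable_const)).nullMeasurableSet)]
  congr 1
  ext x
  have hnorm : √(‖K.orthogonalProjectionOnto x‖ ^ 2 + ‖Kᗮ.orthogonalProjectionOnto x‖ ^ 2) =
      ‖x‖ := by
    rw [← Submodule.norm_sq_eq_add_norm_sq_projection, Real.sqrt_sq (norm_nonneg _)]
  simp only [mem_inter_iff, mem_preimage, Metric.mem_ball, dist_zero_right, mem_ofPred_eq,
    Submodule.orthogonalDecomposition_apply, hinv, hnorm]

theorem volume_inter_ball_eq_mul {K : Submodule ℝ E} [Nontrivial K] [Nontrivial Kᗮ]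
    {T : Set E} (hT : MeasurableSet T) {S : Set ℝ} (hS : MeasurableSet S)
    (h : ∀ (θ : Metric.sphere (0 : K) 1) (r : ℝ) (z : Kᗮ), 0 < r → z ≠ 0 →
        (r • ((θ : K) : E) + z ∈ T ↔ r ^ 2 / (r ^ 2 + ‖z‖ ^ 2) ∈ S)) :
    volume (T ∩ Metric.ball 0 1) =
      betaMeasure ((finrank ℝ K : ℝ) / 2) ((finrank ℝ Kᗮ : ℝ) / 2) S *
        volume (Metric.ball (0 : E) 1) := by
  obtain ⟨C, hC⟩ := exists_volume_inter_ball_eq K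
  have hK : (0 : ℝ) < finrank ℝ K := by exact_mod_cast finrank_pos
  have hK' : (0 : ℝ) < finrank ℝ Kᗮ := by exact_mod_cast finrank_pos
  have := isProbabilityMeasureBeta (half_pos hK) (half_pos hK')
  have h1 := hC univ (fun _ => univ) .univ (fun _ => .univ) (by simp)
  rw [univ_inter, measure_univ, lintegral_one] at h1
  rw [hC T (fun _ => S) hT (fun _ => hS) h, h1, lintegral_const]
  ring

/-- Conditioning on the direction `θ`: a bound for each fibre survives averaging over the sphere. -/
theorem volume_inter_ball_le_mul {K : Submodule ℝ E} [Nontrivial K] [Nontrivial Kᗮ]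
    {T : Set E} (hT : MeasurableSet T) {S : Metric.sphere (0 : K) 1 → Set ℝ}
    (hS : ∀ θ, MeasurableSet (S θ))
    (h : ∀ (θ : Metric.sphere (0 : K) 1) (r : ℝ) (z : Kᗮ), 0 < r → z ≠ 0 →
        (r • ((θ : K) : E) + z ∈ T ↔ r ^ 2 / (r ^ 2 + ‖z‖ ^ 2) ∈ S θ)) {M : ℝ≥0∞}
    (hM : ∀ θ, betaMeasure ((finrank ℝ K : ℝ) / 2) ((finrank ℝ Kᗮ : ℝ) / 2) (S θ) ≤ M) :
    volume (T ∩ Metric.ball 0 1) ≤ M * volume (Metric.ball (0 : E) 1) := by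
  obtain ⟨C, hC⟩ := exists_volume_inter_ball_eq K
  have hK : (0 : ℝ) < finrank ℝ K := by exact_mod_cast finrank_pos
  have hK' : (0 : ℝ) < finrank ℝ Kᗮ := by exact_mod_cast finrank_pos
  have := isProbabilityMeasureBeta (half_pos hK) (half_pos hK')
  have h1 := hC univ (fun _ => univ) .univ (fun _ => .univ) (by simp)
  rw [univ_inter, measure_univ, lintegral_one] at h1
  rw [hC T S hT hS h, h1, mul_left_comm]
  gcongr
  exact (lintegral_mono hM).trans_eq (lintegral_const M)

end DJL

/-! ### How much of the ball a fixed linear map nearly preserves -/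

namespace DJL

open Set Module

/-- The vectors whose squared norm `L` distorts by a factor of at most `ε`. -/
def nearIsometrySet {E F : Type*} [NormedAddCommGroup E] [NormedSpace ℝ E]
    [NormedAddCommGroup F] [NormedSpace ℝ F] (ε : ℝ) (L : E →ₗ[ℝ] F) : Set E :=
  {x | |‖L x‖ ^ 2 - ‖x‖ ^ 2| ≤ ε * ‖x‖ ^ 2}

theorem measurableSet_setOf_mul_mem (ε a : ℝ) :
    MeasurableSet {t : ℝ | 1 - ε ≤ t * a ∧ t * a ≤ 1 + ε} :=
  (measurableSet_Icc (a := 1 - ε) (b := 1 + ε)).preimage (f := fun t => t * a) (by fun_prop)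

theorem betaMeasure_setOf_mul_mem (m n : ℕ) {ε a : ℝ} (ha : 0 < a) :
    betaMeasure ((n : ℝ) / 2) (((m : ℝ) - n) / 2) {t | 1 - ε ≤ t * a ∧ t * a ≤ 1 + ε} =
      betaWindow m n ε a⁻¹ := by
  rw [betaWindow]
  congr 1
  ext t
  rw [mem_ofPred_eq, mem_Icc, ← div_eq_mul_inv, ← div_eq_mul_inv, div_le_iff₀ ha, le_div_iff₀ ha]

variable {E F : Type*} [NormedAddCommGroup E] [InnerProductSpace ℝ E]
  [NormedAddCommGroup F] [InnerProductSpace ℝ F]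

theorem measurableSet_nearIsometrySet [FiniteDimensional ℝ E] [MeasurableSpace E] [BorelSpace E]
    (ε : ℝ) (L : E →ₗ[ℝ] F) : MeasurableSet (nearIsometrySet ε L) := by
  have hL : Continuous L := L.continuous_of_finiteDimensional
  exact (isClosed_le (by fun_prop) (by fun_prop)).measurableSet

/-- `L` sees only the `K` component, so by Pythagoras `‖L x‖² / ‖x‖²` is the ratio times `‖L θ‖²`.
-/
theorem smul_add_mem_nearIsometrySet_iff {K : Submodule ℝ E} {L : E →ₗ[ℝ] F}
    (hK : Kᗮ ≤ LinearMap.ker L) (ε : ℝ) (θ : Metric.sphere (0 : K) 1) {r : ℝ} (z : Kᗮ)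
    (hr : 0 < r) :
    r • ((θ : K) : E) + z ∈ nearIsometrySet ε L ↔
      r ^ 2 / (r ^ 2 + ‖z‖ ^ 2) ∈ {t : ℝ | 1 - ε ≤ t * ‖L (θ : K)‖ ^ 2 ∧
        t * ‖L (θ : K)‖ ^ 2 ≤ 1 + ε} := by
  have hLz : L z = 0 := hK z.2
  have hθ : ‖((θ : K) : E)‖ = 1 := norm_eq_of_mem_sphere θ
  have horth : inner ℝ (r • ((θ : K) : E)) (z : E) = 0 := by
    rw [inner_smul_left, Submodule.inner_right_of_mem_orthogonal (θ : K).2 z.2, mul_zero]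
  have hx : ‖r • ((θ : K) : E) + z‖ ^ 2 = r ^ 2 + ‖z‖ ^ 2 := by
    rw [sq, norm_add_sq_eq_norm_sq_add_norm_sq_of_inner_eq_zero _ _ horth, norm_smul, hθ,
      Real.norm_of_nonneg hr.le]
    simp [sq]
  have hLx : ‖L (r • ((θ : K) : E) + z)‖ ^ 2 = r ^ 2 * ‖L (θ : K)‖ ^ 2 := by
    rw [map_add, hLz, add_zero, map_smul, norm_smul, mul_pow, Real.norm_of_nonneg hr.le]
  have hpos : 0 < r ^ 2 + ‖z‖ ^ 2 := by positivity
  rw [nearIsometrySet, mem_ofPred_eq, mem_ofPred_eq, hx, hLx, abs_le, div_mul_eq_mul_div,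
    le_div_iff₀ hpos, div_le_iff₀ hpos]
  constructor <;> rintro ⟨h1, h2⟩ <;> constructor <;> linarith

theorem finrank_orthogonal_cast [FiniteDimensional ℝ E] {K : Submodule ℝ E} {m n : ℕ}
    (hE : finrank ℝ E = m)
    (hK : finrank ℝ K = n) : (finrank ℝ Kᗮ : ℝ) = (m : ℝ) - n := by
  rw [← hE, ← K.finrank_add_finrank_orthogonal, hK]
  push_cast
  ring

variable [FiniteDimensional ℝ E] [MeasurableSpace E] [BorelSpace E]

theorem volume_nearIsometrySet_inter_ball_eq {m n : ℕ} (hn : 1 ≤ n) (hnm : n < m) (ε : ℝ)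
    {K : Submodule ℝ E} (hE : finrank ℝ E = m) (hKn : finrank ℝ K = n) {L : E →ₗ[ℝ] F}
    (hK : Kᗮ ≤ LinearMap.ker L) {l : ℝ} (hl : 0 < l)
    (hL : ∀ y ∈ K, ‖L y‖ ^ 2 = l⁻¹ * ‖y‖ ^ 2) :
    volume (nearIsometrySet ε L ∩ Metric.ball 0 1) =
      betaWindow m n ε l * volume (Metric.ball (0 : E) 1) := by
  have : Nontrivial K := nontrivial_of_finrank_pos (R := ℝ) (by omega)
  have hK' := K.finrank_add_finrank_orthogonal
  have : Nontrivial Kᗮ := nontrivial_of_finrank_pos (R := ℝ) (by omega)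
  rw [volume_inter_ball_eq_mul (K := K) (measurableSet_nearIsometrySet ε L)
      (measurableSet_setOf_mul_mem ε l⁻¹),
    finrank_orthogonal_cast hE hKn, hKn, betaMeasure_setOf_mul_mem m n (inv_pos.2 hl), inv_inv]
  intro θ r z hr _
  have hθ : ‖((θ : K) : E)‖ = 1 := norm_eq_of_mem_sphere θ
  have := smul_add_mem_nearIsometrySet_iff hK ε θ z hr
  rwa [hL _ (θ : K).2, hθ, one_pow, mul_one] at this

theorem volume_nearIsometrySet_inter_ball_le [FiniteDimensional ℝ F] {m n : ℕ} (hn : 1 ≤ n)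
    (hnm : n < m) {ε : ℝ} (hε : ε < 1) (hE : finrank ℝ E = m) (hF : finrank ℝ F = n)
    (L : E →ₗ[ℝ] F) {M : ℝ≥0∞} (hM : ∀ l, betaWindow m n ε l ≤ M) :
    volume (nearIsometrySet ε L ∩ Metric.ball 0 1) ≤ M * volume (Metric.ball (0 : E) 1) := by
  -- The kernel may be larger than `m - n`; a subspace of exactly this dimension keeps the Beta
  -- parameters independent of the rank of `L`.
  obtain ⟨N, hN, hNk⟩ : ∃ N : Submodule ℝ E, finrank ℝ N = m - n ∧ N ≤ LinearMap.ker L := by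
    have hle : m - n ≤ finrank ℝ (LinearMap.ker L) := by
      have h1 := L.finrank_range_add_finrank_ker
      have h2 := (LinearMap.range L).finrank_le
      omega
    obtain ⟨f, hf⟩ := exists_linearIndependent_of_le_finrank hle
    refine ⟨Submodule.span ℝ (range fun i => (f i : E)), ?_, ?_⟩
    · have hspan := finrank_span_eq_card (hf.map' (LinearMap.ker L).subtype (Submodule.ker_subtype _))
      rwa [Fintype.card_fin] at hspan
    · rw [Submodule.span_le]
      rintro _ ⟨i, rfl⟩
      exact (f i).2
  have hN' := N.finrank_add_finrank_orthogonal
  have hK : Nᗮᗮ ≤ LinearMap.ker L := by rwa [N.orthogonal_orthogonal]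
  have hKn : finrank ℝ Nᗮ = n := by omega
  have : Nontrivial Nᗮ := nontrivial_of_finrank_pos (R := ℝ) (by omega)
  have hK' := Nᗮ.finrank_add_finrank_orthogonal
  have : Nontrivial Nᗮᗮ := nontrivial_of_finrank_pos (R := ℝ) (by omega)
  refine volume_inter_ball_le_mul (K := Nᗮ) (measurableSet_nearIsometrySet ε L) ?_
    (fun θ r z hr _ => smul_add_mem_nearIsometrySet_iff hK ε θ z hr) ?_
  · exact fun θ => measurableSet_setOf_mul_mem ε _
  · intro θ
    rw [finrank_orthogonal_cast hE hKn, hKn]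
    -- If `L θ = 0` no ratio works, because `1 - ε > 0`; otherwise the condition is the window at `l
    -- = ‖L θ‖⁻²`.
    rcases (sq_nonneg ‖L (θ : Nᗮ)‖).eq_or_lt with h0 | hpos
    · have : {t : ℝ | 1 - ε ≤ t * ‖L (θ : Nᗮ)‖ ^ 2 ∧ t * ‖L (θ : Nᗮ)‖ ^ 2 ≤ 1 + ε} = ∅ := by
        ext t
        simp only [← h0, mul_zero, mem_ofPred_eq, mem_empty_iff_false, iff_false]
        intro h
        linarith [h.1]
      rw [this, measure_empty]
      exact zero_le
    · rw [betaMeasure_setOf_mul_mem m n hpos]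
      exact hM _

theorem rectId_mul_transpose {n m : ℕ} (hnm : n ≤ m) : rectId n m * (rectId n m)ᵀ = 1 := by
  ext i j
  rw [Matrix.mul_apply, Finset.sum_eq_single (Fin.castLE hnm i)]
  · simp [rectId, Matrix.one_apply, Fin.ext_iff, eq_comm]
  · intro b _ hb
    have : (i : ℕ) ≠ b := fun h => hb (Fin.ext h.symm)
    simp [rectId, this]
  · simp

theorem norm_mulVec_sq_of_transpose_mul {n k : ℕ} {A : Matrix (Fin k) (Fin n) ℝ}
    (hA : Aᵀ * A = 1) (x : EuclideanSpace ℝ (Fin n)) :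
    ‖Matrix.toEuclideanLin A x‖ ^ 2 = ‖x‖ ^ 2 := by
  rw [EuclideanSpace.real_norm_sq_eq, EuclideanSpace.real_norm_sq_eq]
  have h1 : ∀ {j : ℕ} (v : Fin j → ℝ), ∑ i, v i ^ 2 = v ⬝ᵥ v := fun v => by
    simp [dotProduct, sq]
  rw [h1, h1, Matrix.toLpLin_apply, Matrix.dotProduct_mulVec, ← Matrix.mulVec_transpose,
    Matrix.mulVec_mulVec, hA, Matrix.one_mulVec]

/-- From `J Jᵀ = 1`, the map `J` is isometric on `(ker J)ᗮ`, so its scaling meets the equality case.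
-/
theorem volume_nearIsometrySet_rectId {m n : ℕ} (hn : 1 ≤ n) (hnm : n < m) (ε : ℝ) {l : ℝ}
    (hl : 0 < l) :
    volume (nearIsometrySet ε (√(l⁻¹) • Matrix.toEuclideanLin (rectId n m)) ∩ Metric.ball 0 1) =
      betaWindow m n ε l * volume (Metric.ball (0 : EuclideanSpace ℝ (Fin m)) 1) := by
  set J := Matrix.toEuclideanLin (rectId n m)
  set J' := Matrix.toEuclideanLin (rectId n m)ᵀ
  have hJJ' : ∀ x, J (J' x) = x := by
    intro x
    have h := Matrix.toLpLin_mul (2 : ℝ≥0∞) 2 2 (rectId n m) (rectId n m)ᵀ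
    rw [rectId_mul_transpose hnm.le, Matrix.toLpLin_one] at h
    exact (congrArg (fun f => f x) h).symm
  have hrange : LinearMap.range J = ⊤ := LinearMap.range_eq_top.2 fun x => ⟨J' x, hJJ' x⟩
  have hrank : finrank ℝ (LinearMap.ker J) = m - n := by
    have := J.finrank_range_add_finrank_ker
    rw [hrange, finrank_top] at this
    simp only [finrank_euclideanSpace, Fintype.card_fin] at this
    omega
  have hKn : finrank ℝ (LinearMap.ker J)ᗮ = n := by
    have := (LinearMap.ker J).finrank_add_finrank_orthogonal
    simp only [finrank_euclideanSpace, Fintype.card_fin] at this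
    omega
  have hadj : ∀ x y, inner ℝ (J' x) y = inner ℝ x (J y) := by
    intro x y
    simp only [EuclideanSpace.inner_eq_star_dotProduct, star_trivial, J, J', Matrix.toLpLin_apply]
    rw [Matrix.mulVec_transpose, dotProduct_comm, ← Matrix.dotProduct_mulVec, dotProduct_comm]
  refine volume_nearIsometrySet_inter_ball_eq hn hnm ε (K := (LinearMap.ker J)ᗮ) (by simp) hKn
    ?_ hl ?_
  · rw [Submodule.orthogonal_orthogonal]
    intro x hx
    rw [LinearMap.mem_ker] at hx
    simp [hx]
  · intro y hy
    -- This difference lies in both `ker J` and its orthogonal complement, hence vanishes.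
    have hker : J' (J y) - y ∈ LinearMap.ker J := by
      rw [LinearMap.mem_ker, map_sub, hJJ', sub_self]
    have horth : J' (J y) - y ∈ (LinearMap.ker J)ᗮ := by
      refine Submodule.sub_mem _ ((Submodule.mem_orthogonal' _ _).2 fun v hv => ?_) hy
      rw [hadj, LinearMap.mem_ker.1 hv, inner_zero_right]
    have hyy : J' (J y) = y := by
      rw [← sub_eq_zero, ← inner_self_eq_zero (𝕜 := ℝ)]
      exact Submodule.inner_right_of_mem_orthogonal hker horth
    have : ‖J y‖ ^ 2 = ‖y‖ ^ 2 := by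
      rw [← real_inner_self_eq_norm_sq, ← real_inner_self_eq_norm_sq, ← hadj, hyy]
    rw [LinearMap.smul_apply, norm_smul, mul_pow, this, Real.norm_of_nonneg (Real.sqrt_nonneg _),
      Real.sq_sqrt (inv_pos.2 hl).le]

end DJL

namespace DJL

open Set Module

/-! ### Maximizing the Beta window -/

section BetaWindow

variable {m n : ℕ} {ε : ℝ}

theorem betaWindow_of_nonpos (m n : ℕ) (hε0 : 0 < ε) {l : ℝ} (hl : l ≤ 0) :
    betaWindow m n ε l = 0 := by
  have h : betaMeasure ((n : ℝ) / 2) (((m : ℝ) - n) / 2) (Iic 0) = 0 := by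
    rw [betaMeasure, withDensity_apply _ measurableSet_Iic]
    exact setLIntegral_eq_zero measurableSet_Iic fun x hx => betaPDF_eq_zero_of_nonpos hx
  exact measure_mono_null (fun t ht => ht.2.trans (by nlinarith)) h

theorem betaWindow_of_one_le (m n : ℕ) {l : ℝ} (hl : 1 ≤ (1 - ε) * l) :
    betaWindow m n ε l = 0 := by
  have h : betaMeasure ((n : ℝ) / 2) (((m : ℝ) - n) / 2) (Ici 1) = 0 := by
    rw [betaMeasure, withDensity_apply _ measurableSet_Ici]
    exact setLIntegral_eq_zero measurableSet_Ici fun x hx => betaPDF_eq_zero_of_one_le hx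
  exact measure_mono_null (fun t ht => hl.trans ht.1) h

theorem integrable_betaPDFReal {a b : ℝ} (ha : 0 < a) (hb : 0 < b) :
    Integrable (betaPDFReal a b) := by
  have h0 : 0 ≤ᵐ[volume] betaPDFReal a b := by
    refine Filter.Eventually.of_forall fun x => ?_
    by_cases hx : 0 < x ∧ x < 1
    · exact (betaPDFReal_pos hx.1 hx.2 ha hb).le
    · simp [betaPDFReal, hx]
  rw [← lintegral_ofReal_ne_top_iff_integrable
    (measurable_betaPDFReal a b).aestronglyMeasurable h0]
  exact (lintegral_betaPDF_eq_one ha hb).trans_ne ENNReal.one_ne_top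

theorem betaWindow_eq_ofReal (hn : 1 ≤ n) (hnm : n < m) (hε0 : 0 < ε) {l : ℝ} (hl : 0 ≤ l) :
    betaWindow m n ε l = ENNReal.ofReal (∫ t in ((1 - ε) * l)..((1 + ε) * l),
      betaPDFReal ((n : ℝ) / 2) (((m : ℝ) - n) / 2) t) := by
  have ha : 0 < (n : ℝ) / 2 := by positivity
  have hb : 0 < ((m : ℝ) - n) / 2 := half_pos (sub_pos.2 (by exact_mod_cast hnm))
  rw [intervalIntegral.integral_of_le (by nlinarith), ← integral_Icc_eq_integral_Ioc,
    ofReal_integral_eq_lintegral_ofReal (integrable_betaPDFReal ha hb).integrableOn, betaWindow,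
    betaMeasure, withDensity_apply _ measurableSet_Icc]
  · rfl
  · refine Filter.Eventually.of_forall fun x => ?_
    by_cases hx : 0 < x ∧ x < 1
    · exact (betaPDFReal_pos hx.1 hx.2 ha hb).le
    · simp [betaPDFReal, hx]

theorem exists_forall_betaWindow_le (hn : 1 ≤ n) (hnm : n < m) (hε0 : 0 < ε) (hε : ε < 1) :
    ∃ l, ∀ l', betaWindow m n ε l' ≤ betaWindow m n ε l := by
  have ha : 0 < (n : ℝ) / 2 := by positivity
  have hb : 0 < ((m : ℝ) - n) / 2 := half_pos (sub_pos.2 (by exact_mod_cast hnm))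
  have hint := integrable_betaPDFReal ha hb
  have hcont : Continuous fun l : ℝ => ∫ t in ((1 - ε) * l)..((1 + ε) * l),
      betaPDFReal ((n : ℝ) / 2) (((m : ℝ) - n) / 2) t := by
    have h := intervalIntegral.continuous_primitive (fun a b => hint.intervalIntegrable) 0
    have : ∀ l : ℝ, ∫ t in ((1 - ε) * l)..((1 + ε) * l),
        betaPDFReal ((n : ℝ) / 2) (((m : ℝ) - n) / 2) t =
        (∫ t in (0 : ℝ)..((1 + ε) * l), betaPDFReal ((n : ℝ) / 2) (((m : ℝ) - n) / 2) t) -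
        ∫ t in (0 : ℝ)..((1 - ε) * l), betaPDFReal ((n : ℝ) / 2) (((m : ℝ) - n) / 2) t :=
      fun l => (intervalIntegral.integral_interval_sub_left hint.intervalIntegrable
        hint.intervalIntegrable).symm
    simp_rw [this]
    exact (h.comp (by fun_prop : Continuous fun l : ℝ => (1 + ε) * l)).sub
      (h.comp (by fun_prop : Continuous fun l : ℝ => (1 - ε) * l))
  have h1ε : 0 < 1 - ε := sub_pos.2 hε
  -- For `l` outside this interval the window misses `(0, 1)` and has probability zero.
  obtain ⟨l, hl, hmax⟩ := (isCompact_Icc (a := (0 : ℝ)) (b := 1 / (1 - ε))).exists_isMaxOn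
    (nonempty_Icc.2 (by positivity)) hcont.continuousOn
  refine ⟨l, fun l' => ?_⟩
  rcases le_total l' 0 with h0 | h0
  · rw [betaWindow_of_nonpos m n hε0 h0]
    exact zero_le
  rcases le_total l' (1 / (1 - ε)) with h1 | h1
  · rw [betaWindow_eq_ofReal hn hnm hε0 h0, betaWindow_eq_ofReal hn hnm hε0 hl.1]
    exact ENNReal.ofReal_le_ofReal (hmax ⟨h0, h1⟩)
  · rw [betaWindow_of_one_le m n (by rwa [div_le_iff₀' h1ε] at h1)]
    exact zero_le

theorem pos_of_forall_betaWindow_le (hn : 1 ≤ n) (hnm : n < m) (hε0 : 0 < ε) {l : ℝ}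
    (hl : ∀ l', betaWindow m n ε l' ≤ betaWindow m n ε l) : 0 < l := by
  by_contra! h
  have ha : 0 < (n : ℝ) / 2 := by positivity
  have hb : 0 < ((m : ℝ) - n) / 2 := half_pos (sub_pos.2 (by exact_mod_cast hnm))
  -- This choice puts the right end of the window at `1`, so it overlaps `(0, 1)` in an interval
  -- where the density is positive.
  have h1 := hl (1 / (1 + ε))
  rw [betaWindow_of_nonpos m n hε0 h, nonpos_iff_eq_zero] at h1
  refine absurd h1 (ne_of_gt ?_)
  have hlt : max 0 ((1 - ε) * (1 / (1 + ε))) < 1 := by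
    refine max_lt one_pos ?_
    rw [mul_one_div, div_lt_one (by positivity)]
    linarith
  rw [betaWindow, betaMeasure, withDensity_apply _ measurableSet_Icc,
    setLIntegral_pos_iff (by unfold betaPDF; fun_prop)]
  refine lt_of_lt_of_le ?_ (measure_mono (s := Ioo (max 0 ((1 - ε) * (1 / (1 + ε)))) 1) ?_)
  · rw [Real.volume_Ioo, ENNReal.ofReal_pos]
    exact sub_pos.2 hlt
  · rintro t ⟨ht0, ht1⟩
    rw [max_lt_iff] at ht0
    refine ⟨?_, ht0.2.le, ht1.le.trans_eq (by field_simp)⟩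
    exact (ENNReal.ofReal_pos.2 (betaPDFReal_pos ht0.1 ht1 ha hb)).ne'

end BetaWindow

/-! ### Lower bound for every distribution -/

section LowerBound

variable {n m : ℕ}

theorem distortionEvent_eq (ε : ℝ) (x : EuclideanSpace ℝ (Fin m)) :
    distortionEvent (n := n) ε x = {A | x ∉ nearIsometrySet ε (Matrix.toEuclideanLin A)} := by
  ext A
  exact (not_le (α := ℝ)).symm

theorem measurableSet_distortion (ε : ℝ) :
    MeasurableSet {p : Matrix (Fin n) (Fin m) ℝ × EuclideanSpace ℝ (Fin m) |
      p.2 ∉ nearIsometrySet ε (Matrix.toEuclideanLin p.1)} := by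
  have hmul : Continuous fun p : Matrix (Fin n) (Fin m) ℝ × EuclideanSpace ℝ (Fin m) =>
      Matrix.toEuclideanLin p.1 p.2 := by
    simp only [Matrix.toLpLin_apply]
    exact (PiLp.continuous_toLp 2 _).comp
      (continuous_fst.matrix_mulVec ((PiLp.continuous_ofLp 2 _).comp continuous_snd))
  have hclosed : IsClosed {p : Matrix (Fin n) (Fin m) ℝ × EuclideanSpace ℝ (Fin m) |
      p.2 ∈ nearIsometrySet ε (Matrix.toEuclideanLin p.1)} :=
    isClosed_le (((hmul.norm.pow 2).sub (continuous_snd.norm.pow 2)).abs)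
      ((continuous_snd.norm.pow 2).const_mul ε)
  exact hclosed.measurableSet.compl

/-- Both inequalities below evaluate the same product measure, of `𝒜` with volume on the ball:
slicing by `x` gives the upper estimate, slicing by `A` the lower one. -/
theorem one_sub_le_worstDistortion (hn : 1 ≤ n) (hnm : n < m) {ε : ℝ} (hε : ε < 1) {M : ℝ≥0∞}
    (hM : ∀ l, betaWindow m n ε l ≤ M)
    (𝒜 : ProbabilityMeasure (Matrix (Fin n) (Fin m) ℝ)) : 1 - M ≤ worstDistortion ε 𝒜 := by
  set c := volume (Metric.ball (0 : EuclideanSpace ℝ (Fin m)) 1)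
  have hc0 : c ≠ 0 := (Metric.measure_ball_pos _ _ one_pos).ne'
  have hc : c ≠ ∞ := measure_ball_lt_top.ne
  set D := {p : Matrix (Fin n) (Fin m) ℝ × EuclideanSpace ℝ (Fin m) |
      p.2 ∉ nearIsometrySet ε (Matrix.toEuclideanLin p.1)}
  have hD : MeasurableSet D := measurableSet_distortion ε
  set β := (volume : Measure (EuclideanSpace ℝ (Fin m))).restrict (Metric.ball 0 1)
  have hβ : β univ = c := Measure.restrict_apply_univ _
  have hfin : IsFiniteMeasure β := ⟨by rw [hβ]; exact hc.lt_top⟩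
  have hupper : ((𝒜 : Measure (Matrix (Fin n) (Fin m) ℝ)).prod β) D ≤ worstDistortion ε 𝒜 * c := by
    rw [Measure.prod_apply_symm hD, ← hβ, ← lintegral_const]
    refine lintegral_mono fun x => ?_
    refine le_trans (le_of_eq ?_) (le_iSup _ x)
    rw [distortionEvent_eq]
    rfl
  have hlower : (1 - M) * c ≤ ((𝒜 : Measure (Matrix (Fin n) (Fin m) ℝ)).prod β) D := by
    rw [Measure.prod_apply hD]
    calc (1 - M) * c = ∫⁻ _, (1 - M) * c ∂(𝒜 : Measure (Matrix (Fin n) (Fin m) ℝ)) := by simp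
      _ ≤ _ := lintegral_mono fun A => ?_
    rw [ENNReal.sub_mul fun _ _ => hc, one_mul, tsub_le_iff_right]
    calc c = β univ := hβ.symm
      _ = β (nearIsometrySet ε (Matrix.toEuclideanLin A))ᶜ +
          β (nearIsometrySet ε (Matrix.toEuclideanLin A)) := by
        rw [add_comm, measure_add_measure_compl (measurableSet_nearIsometrySet ε _)]
      _ ≤ _ := by
        refine add_le_add le_rfl ?_
        rw [Measure.restrict_apply (measurableSet_nearIsometrySet ε _)]
        exact volume_nearIsometrySet_inter_ball_le hn hnm hε (by simp) (by simp) _ hM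
  exact (ENNReal.mul_le_mul_iff_left hc0 hc).1 (hlower.trans hupper)

end LowerBound

/-! ### Failure probability of the Haar projection -/

section Haar

variable {m : ℕ}

/-- The reflection in the hyperplane orthogonal to `x - y` carries `x` to `y`. -/
theorem exists_orthogonal_mulVec_eq {x y : EuclideanSpace ℝ (Fin m)} (h : ‖x‖ = ‖y‖) :
    ∃ W : Matrix.orthogonalGroup (Fin m) ℝ,
      Matrix.toEuclideanLin (W : Matrix (Fin m) (Fin m) ℝ) x = y := by
  set R := (ℝ ∙ (x - y))ᗮ.reflection
  set b := EuclideanSpace.basisFun (Fin m) ℝ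
  refine ⟨⟨_, R.toMatrix_mem_unitaryGroup b b⟩, ?_⟩
  simp only [Matrix.toEuclideanLin_eq_toLin_orthonormal]
  rw [Matrix.toLin_toMatrix]
  exact Submodule.reflection_sub h

theorem norm_toEuclideanLin_orthogonal {d : ℕ} (U : Matrix.orthogonalGroup (Fin d) ℝ)
    (x : EuclideanSpace ℝ (Fin d)) :
    ‖Matrix.toEuclideanLin (U : Matrix (Fin d) (Fin d) ℝ) x‖ = ‖x‖ := by
  have hU : (U : Matrix (Fin d) (Fin d) ℝ)ᵀ * U = 1 := by
    simpa [Matrix.star_eq_conjTranspose] using Matrix.mem_unitaryGroup_iff'.1 U.2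
  exact (sq_eq_sq₀ (norm_nonneg _) (norm_nonneg _)).1 (norm_mulVec_sq_of_transpose_mul hU x)

theorem norm_toEuclideanLin_transpose_orthogonal {d : ℕ} (U : Matrix.orthogonalGroup (Fin d) ℝ)
    (x : EuclideanSpace ℝ (Fin d)) :
    ‖Matrix.toEuclideanLin (U : Matrix (Fin d) (Fin d) ℝ)ᵀ x‖ = ‖x‖ := by
  have hU : (U : Matrix (Fin d) (Fin d) ℝ)ᵀᵀ * (U : Matrix (Fin d) (Fin d) ℝ)ᵀ = 1 := by
    simpa [Matrix.star_eq_conjTranspose] using Matrix.mem_unitaryGroup_iff.1 U.2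
  exact (sq_eq_sq₀ (norm_nonneg _) (norm_nonneg _)).1 (norm_mulVec_sq_of_transpose_mul hU x)

theorem toEuclideanLin_mul_apply {i j k : ℕ} (A : Matrix (Fin i) (Fin j) ℝ)
    (B : Matrix (Fin j) (Fin k) ℝ) (x : EuclideanSpace ℝ (Fin k)) :
    Matrix.toEuclideanLin (A * B) x = Matrix.toEuclideanLin A (Matrix.toEuclideanLin B x) :=
  congrArg (fun f => f x) (Matrix.toLpLin_mul (2 : ℝ≥0∞) 2 2 A B)

theorem continuous_transpose_orthogonal_apply :
    Continuous fun p : Matrix.orthogonalGroup (Fin m) ℝ × EuclideanSpace ℝ (Fin m) =>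
      Matrix.toEuclideanLin (p.1 : Matrix (Fin m) (Fin m) ℝ)ᵀ p.2 := by
  simp only [Matrix.toLpLin_apply]
  exact (PiLp.continuous_toLp 2 _).comp
    ((continuous_subtype_val.comp continuous_fst).matrix_transpose.matrix_mulVec
      ((PiLp.continuous_ofLp 2 _).comp continuous_snd))

/-- An orthogonal `W` takes `y` to a nonzero multiple of `x`. Left translation by `W⁻¹` preserves
Haar measure, and the cone property absorbs the scalar. -/
theorem uniformOrthogonal_setOf_mem_eq {T : Set (EuclideanSpace ℝ (Fin m))}
    (hcone : ∀ c : ℝ, c ≠ 0 → ∀ x, c • x ∈ T ↔ x ∈ T) {x y : EuclideanSpace ℝ (Fin m)}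
    (hx : x ≠ 0) (hy : y ≠ 0) :
    (uniformOrthogonal m : Measure (Matrix.orthogonalGroup (Fin m) ℝ))
        {V | Matrix.toEuclideanLin (V : Matrix (Fin m) (Fin m) ℝ)ᵀ x ∈ T} =
      (uniformOrthogonal m : Measure (Matrix.orthogonalGroup (Fin m) ℝ))
        {V | Matrix.toEuclideanLin (V : Matrix (Fin m) (Fin m) ℝ)ᵀ y ∈ T} := by
  have hx' := norm_ne_zero_iff.2 hx
  have hy' := norm_ne_zero_iff.2 hy
  obtain ⟨W, hW⟩ := exists_orthogonal_mulVec_eq (x := y) (y := (‖y‖ / ‖x‖) • x) (by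
    rw [norm_smul, norm_div, norm_norm, norm_norm, div_mul_cancel₀ _ hx'])
  change Measure.haarMeasure ⊤ _ = Measure.haarMeasure ⊤ _
  rw [← measure_preimage_mul (Measure.haarMeasure ⊤) W⁻¹
    {V | Matrix.toEuclideanLin (V : Matrix (Fin m) (Fin m) ℝ)ᵀ y ∈ T}]
  congr 1
  ext V
  have hWV : (((W⁻¹ * V : Matrix.orthogonalGroup (Fin m) ℝ)) : Matrix (Fin m) (Fin m) ℝ)ᵀ =
      (V : Matrix (Fin m) (Fin m) ℝ)ᵀ * (W : Matrix (Fin m) (Fin m) ℝ) := by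
    have : ((W⁻¹ : Matrix.orthogonalGroup (Fin m) ℝ) : Matrix (Fin m) (Fin m) ℝ) =
        (W : Matrix (Fin m) (Fin m) ℝ)ᵀ := rfl
    rw [Submonoid.coe_mul, this, Matrix.transpose_mul, Matrix.transpose_transpose]
  rw [mem_preimage, mem_ofPred_eq, mem_ofPred_eq, hWV, toEuclideanLin_mul_apply, hW, map_smul,
    hcone _ (div_ne_zero hy' hx')]

/-- Tonelli on the pairs `(V, y)` with `Vᵀ y ∈ T`: the slice at almost every `y` has the same Haar
measure, and the slice at each `V` has the volume of `T` in the ball because `Vᵀ` is an isometry. -/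
theorem uniformOrthogonal_setOf_mem_mul_volume_ball {T : Set (EuclideanSpace ℝ (Fin m))}
    (hT : MeasurableSet T) (hcone : ∀ c : ℝ, c ≠ 0 → ∀ x, c • x ∈ T ↔ x ∈ T)
    {x : EuclideanSpace ℝ (Fin m)} (hx : x ≠ 0) :
    (uniformOrthogonal m : Measure (Matrix.orthogonalGroup (Fin m) ℝ))
        {V | Matrix.toEuclideanLin (V : Matrix (Fin m) (Fin m) ℝ)ᵀ x ∈ T} *
      volume (Metric.ball (0 : EuclideanSpace ℝ (Fin m)) 1) = volume (T ∩ Metric.ball 0 1) := by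
  have : Nontrivial (EuclideanSpace ℝ (Fin m)) := ⟨x, 0, hx⟩
  set β := (volume : Measure (EuclideanSpace ℝ (Fin m))).restrict (Metric.ball 0 1)
  set ν := (uniformOrthogonal m : Measure (Matrix.orthogonalGroup (Fin m) ℝ))
  have hfin : IsFiniteMeasure β :=
    ⟨by rw [Measure.restrict_apply_univ]; exact measure_ball_lt_top⟩
  have hD := continuous_transpose_orthogonal_apply.measurable hT
  have h1 := Measure.prod_apply_symm (μ := ν) (ν := β) hD
  have h2 := Measure.prod_apply (μ := ν) (ν := β) hD
  have h3 : ∀ᵐ y ∂β, ν ((fun V => (V, y)) ⁻¹' ((fun p : Matrix.orthogonalGroup (Fin m) ℝ ×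
      EuclideanSpace ℝ (Fin m) => Matrix.toEuclideanLin (p.1 : Matrix (Fin m) (Fin m) ℝ)ᵀ p.2)
      ⁻¹' T)) = ν {V | Matrix.toEuclideanLin (V : Matrix (Fin m) (Fin m) ℝ)ᵀ x ∈ T} := by
    refine ae_restrict_of_ae ?_
    filter_upwards [Measure.ae_ne volume (0 : EuclideanSpace ℝ (Fin m))] with y hy
    exact uniformOrthogonal_setOf_mem_eq hcone hy hx
  have h4 : ∀ V : Matrix.orthogonalGroup (Fin m) ℝ, β (Prod.mk V ⁻¹'
      ((fun p : Matrix.orthogonalGroup (Fin m) ℝ × EuclideanSpace ℝ (Fin m) =>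
        Matrix.toEuclideanLin (p.1 : Matrix (Fin m) (Fin m) ℝ)ᵀ p.2) ⁻¹' T)) =
      volume (T ∩ Metric.ball 0 1) := by
    intro V
    let e : EuclideanSpace ℝ (Fin m) ≃ₗᵢ[ℝ] EuclideanSpace ℝ (Fin m) :=
      LinearIsometry.toLinearIsometryEquiv
        ⟨Matrix.toEuclideanLin (V : Matrix (Fin m) (Fin m) ℝ)ᵀ,
          norm_toEuclideanLin_transpose_orthogonal V⟩ rfl
    have he : ∀ z, e z = Matrix.toEuclideanLin (V : Matrix (Fin m) (Fin m) ℝ)ᵀ z := fun _ => rfl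
    rw [← e.measurePreserving.measure_preimage
      (hT.inter Metric.isOpen_ball.measurableSet).nullMeasurableSet,
      Measure.restrict_apply (hD.preimage measurable_prodMk_left)]
    congr 1
    ext z
    have := norm_toEuclideanLin_transpose_orthogonal V z
    simp only [mem_inter_iff, mem_preimage, Metric.mem_ball, dist_zero_right, he, this]
  rw [lintegral_congr_ae h3, lintegral_const, Measure.restrict_apply_univ] at h1
  rw [← h1, h2, lintegral_congr h4, lintegral_const, measure_univ, mul_one]

/-- The factor `U` preserves norms and drops out; `Vᵀ` preserves `‖x‖`, so only the position of `Vᵀ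
x` relative to a fixed cone matters. -/
theorem scaledProjection_mem_distortionEvent_iff {n : ℕ} (ε : ℝ) {l : ℝ} (hl : 0 < l)
    (x : EuclideanSpace ℝ (Fin m))
    (p : Matrix.orthogonalGroup (Fin n) ℝ × Matrix.orthogonalGroup (Fin m) ℝ) :
    scaledProjection n m l p ∈ distortionEvent ε x ↔
      Matrix.toEuclideanLin (p.2 : Matrix (Fin m) (Fin m) ℝ)ᵀ x ∈
        (nearIsometrySet ε (√(l⁻¹) • Matrix.toEuclideanLin (rectId n m)))ᶜ := by
  have hl' : l ^ (-(1 / 2) : ℝ) = √(l⁻¹) := by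
    rw [Real.rpow_neg hl.le, ← Real.sqrt_eq_rpow, Real.sqrt_inv]
  have h1 : ‖Matrix.toEuclideanLin (scaledProjection n m l p) x‖ =
      ‖(√(l⁻¹) • Matrix.toEuclideanLin (rectId n m))
        (Matrix.toEuclideanLin (p.2 : Matrix (Fin m) (Fin m) ℝ)ᵀ x)‖ := by
    rw [scaledProjection, hl', map_smul, LinearMap.smul_apply, norm_smul,
      toEuclideanLin_mul_apply, toEuclideanLin_mul_apply, norm_toEuclideanLin_orthogonal,
      LinearMap.smul_apply, norm_smul]
  rw [distortionEvent_eq, mem_compl_iff, mem_ofPred_eq, nearIsometrySet, nearIsometrySet,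
    mem_ofPred_eq, mem_ofPred_eq, h1, norm_toEuclideanLin_transpose_orthogonal]

theorem haarProjectionLaw_distortionEvent {n : ℕ} (ε : ℝ) {l : ℝ} (hl : 0 < l)
    (x : EuclideanSpace ℝ (Fin m)) :
    (haarProjectionLaw n m l : Measure (Matrix (Fin n) (Fin m) ℝ)) (distortionEvent ε x) =
      (uniformOrthogonal m : Measure (Matrix.orthogonalGroup (Fin m) ℝ))
        {V | Matrix.toEuclideanLin (V : Matrix (Fin m) (Fin m) ℝ)ᵀ x ∈
          (nearIsometrySet ε (√(l⁻¹) • Matrix.toEuclideanLin (rectId n m)))ᶜ} := by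
  set B := {V : Matrix.orthogonalGroup (Fin m) ℝ |
    Matrix.toEuclideanLin (V : Matrix (Fin m) (Fin m) ℝ)ᵀ x ∈
      (nearIsometrySet ε (√(l⁻¹) • Matrix.toEuclideanLin (rectId n m)))ᶜ} with hB
  have hE : MeasurableSet (distortionEvent (n := n) ε x) := by
    rw [distortionEvent_eq]
    have hA : Measurable fun A : Matrix (Fin n) (Fin m) ℝ => (A, x) :=
      measurable_id.prodMk measurable_const
    exact hA (measurableSet_distortion ε)
  have hpre : scaledProjection n m l ⁻¹' distortionEvent ε x = univ ×ˢ B := by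
    ext p
    rw [mem_preimage, scaledProjection_mem_distortionEvent_iff ε hl]
    simp [hB]
  rw [haarProjectionLaw, ProbabilityMeasure.toMeasure_map,
    Measure.map_apply (measurable_scaledProjection n m l) hE, hpre,
    ProbabilityMeasure.toMeasure_prod, Measure.prod_prod, measure_univ, one_mul]

theorem worstDistortion_haarProjectionLaw {n : ℕ} (hn : 1 ≤ n) (hnm : n < m) (ε : ℝ) {l : ℝ}
    (hl : 0 < l) : worstDistortion ε (haarProjectionLaw n m l) = 1 - betaWindow m n ε l := by
  set L := √(l⁻¹) • Matrix.toEuclideanLin (rectId n m)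
  set T := (nearIsometrySet ε L)ᶜ
  have hN := measurableSet_nearIsometrySet ε L
  set c := volume (Metric.ball (0 : EuclideanSpace ℝ (Fin m)) 1)
  have hc0 : c ≠ 0 := (Metric.measure_ball_pos _ _ one_pos).ne'
  have hc : c ≠ ∞ := measure_ball_lt_top.ne
  have hT : volume (T ∩ Metric.ball 0 1) = (1 - betaWindow m n ε l) * c := by
    have h := measure_inter_add_sdiff (μ := volume) (Metric.ball (0 : EuclideanSpace ℝ (Fin m)) 1) hN
    rw [inter_comm, volume_nearIsometrySet_rectId hn hnm ε hl, add_comm] at h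
    have hne : betaWindow m n ε l * c ≠ ∞ :=
      ne_top_of_le_ne_top hc (le_add_self.trans_eq h)
    rw [ENNReal.sub_mul fun _ _ => hc, one_mul, inter_comm, ← sdiff_eq]
    exact ENNReal.eq_sub_of_add_eq hne h
  have hcone : ∀ a : ℝ, a ≠ 0 → ∀ x, a • x ∈ T ↔ x ∈ T := by
    intro a ha x
    refine not_congr ?_
    have ha2 : 0 < ‖a‖ ^ 2 := by positivity
    rw [nearIsometrySet, mem_ofPred_eq, mem_ofPred_eq, map_smul, norm_smul, norm_smul, mul_pow,
      mul_pow, ← mul_sub, abs_mul, abs_of_pos ha2, mul_left_comm, mul_le_mul_iff_right₀ ha2]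
  have hne : ∀ x ≠ 0, (haarProjectionLaw n m l : Measure (Matrix (Fin n) (Fin m) ℝ))
      (distortionEvent ε x) = 1 - betaWindow m n ε l := by
    intro x hx
    have h := uniformOrthogonal_setOf_mem_mul_volume_ball hN.compl hcone hx
    rw [haarProjectionLaw_distortionEvent ε hl]
    exact (ENNReal.mul_left_inj hc0 hc).1 (h.trans hT)
  refine le_antisymm (iSup_le fun x => ?_) ?_
  -- The zero input never fails, since the defining inequality is strict.
  · rcases eq_or_ne x 0 with rfl | hx
    · have : distortionEvent (n := n) ε (0 : EuclideanSpace ℝ (Fin m)) = ∅ := by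
        ext A
        simp [distortionEvent]
      rw [this, measure_empty]
      exact zero_le
    · exact (hne x hx).le
  · have : Nonempty (Fin m) := ⟨⟨0, by omega⟩⟩
    obtain ⟨x, hx⟩ := exists_ne (0 : EuclideanSpace ℝ (Fin m))
    rw [← hne x hx]
    exact le_iSup (fun x => (haarProjectionLaw n m l : Measure (Matrix (Fin n) (Fin m) ℝ))
      (distortionEvent ε x)) x

end Haar

/-! ### Optimality -/

theorem worstDistortion_haarProjectionLaw_eq_deltaBest {m n : ℕ} (hn : 1 ≤ n) (hnm : n < m)
    {ε : ℝ} (hε0 : 0 < ε) (hε : ε < 1) {l : ℝ}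
    (hl : ∀ l', betaWindow m n ε l' ≤ betaWindow m n ε l) :
    worstDistortion ε (haarProjectionLaw n m l) = deltaBest m n ε := by
  refine le_antisymm (le_iInf fun 𝒜 => ?_) (iInf_le _ _)
  rw [worstDistortion_haarProjectionLaw hn hnm ε (pos_of_forall_betaWindow_le hn hnm hε0 hl)]
  exact one_sub_le_worstDistortion hn hnm hε hl 𝒜

end DJL

theorem theorem1 (m n : ℕ) (hn : 1 ≤ n) (hnm : n < m) (ε : ℝ) (hε0 : 0 < ε) (hε : ε < 1 / 2) :
    -- the infimum defining `δ^Best` is attained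
    (∃ 𝒜 : ProbabilityMeasure (Matrix (Fin n) (Fin m) ℝ),
      DJL.worstDistortion ε 𝒜 = DJL.deltaBest m n ε) ∧
    -- the maximum over `l` exists and gives the value of `δ^Best`
    (∃ M : ℝ≥0∞, IsGreatest (Set.range fun l : ℝ => DJL.betaWindow m n ε l) M ∧
      DJL.deltaBest m n ε = 1 - M) ∧
    -- every maximizer `l` is positive and yields an optimal distribution
    (∀ l : ℝ, (∀ l' : ℝ, DJL.betaWindow m n ε l' ≤ DJL.betaWindow m n ε l) →
      0 < l ∧ DJL.worstDistortion ε (DJL.haarProjectionLaw n m l) = DJL.deltaBest m n ε) := by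
  have hε1 : ε < 1 := by linarith
  have hpos : ∀ l : ℝ, (∀ l' : ℝ, DJL.betaWindow m n ε l' ≤ DJL.betaWindow m n ε l) → 0 < l :=
    fun l hl => DJL.pos_of_forall_betaWindow_le hn hnm hε0 hl
  have hopt : ∀ l : ℝ, (∀ l' : ℝ, DJL.betaWindow m n ε l' ≤ DJL.betaWindow m n ε l) →
      DJL.worstDistortion ε (DJL.haarProjectionLaw n m l) = DJL.deltaBest m n ε :=
    fun l hl => DJL.worstDistortion_haarProjectionLaw_eq_deltaBest hn hnm hε0 hε1 hl
  obtain ⟨l, hl⟩ := DJL.exists_forall_betaWindow_le hn hnm hε0 hε1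
  refine ⟨⟨_, hopt l hl⟩, ⟨DJL.betaWindow m n ε l, ⟨⟨l, rfl⟩, ?_⟩, ?_⟩,
    fun l hl => ⟨hpos l hl, hopt l hl⟩⟩
  · rintro _ ⟨l', rfl⟩
    exact hl l'
  · rw [← hopt l hl, DJL.worstDistortion_haarProjectionLaw hn hnm ε (hpos l hl)]
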